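/- Let $X$ be a path-connected, locally path-connected Hausdorff space, let $E$ and $F$ be path-connected spaces, and let $p\colon E\to X$, $q\colon F\to X$ and $\pi\colon E\to F$ be covering maps with $p=q\circ\pi$. For a covering $r\colon Y\to Z$ let $A(Y/Z)$ denote its group of deck transformations, i.e. the group under composition of all homeomorphisms $\varphi\colon Y\to Y$ with $r\circ\varphi=r$; the covering $r$ is called Galois if $A(Y/Z)$ acts transitively on every fibre of $r$. Since $p=q\circ\pi$, $A(E/F)$ is a subgroup of $A(E/X)$. 1. Suppose that $p\colon E\to X$ is Galois. Then $q\colon F\to X$ is Galois if and only if $A(E/F)$ is a normal subgroup of $A(E/X)$. 2. Suppose that $p\colon E\to X$ and $q\colon F\to X$ are Galois. Then $A(E/F)$ is normal in $A(E/X)$ and $$A(F/X)\cong A(E/X)/A(E/F)$$ as groups. -/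

import Mathlib

section CoveringDeck

variable {E X : Type*} [TopologicalSpace E] [TopologicalSpace X]

/-- The group `A(E/X)` of deck transformations of `p : E → X`: the self-homeomorphisms `φ` of `E`
with `p ∘ φ = p`, under composition. -/
def deckGroup (p : E → X) : Subgroup (E ≃ₜ E) where
  carrier := {φ | ∀ e, p (φ e) = p e}
  one_mem' := fun _ => rfl
  mul_mem' := fun {φ ψ} hφ hψ e => (hφ (ψ e)).trans (hψ e)
  inv_mem' := fun {φ} hφ e => by
    have h := hφ (φ.symm e)
    rw [Homeomorph.apply_symm_apply] at h
    exact h.symm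

/-- A covering `p : E → X` is Galois if its deck transformation group acts transitively on
every fibre. -/
def IsGaloisCovering (p : E → X) : Prop :=
  IsCoveringMap p ∧ ∀ e e' : E, p e = p e' → ∃ φ ∈ deckGroup p, φ e = e'

end CoveringDeck

/-- For `p = q ∘ π`, every deck transformation of `π : E → F` is one of `p : E → X`. -/
theorem deckGroup_le_of_comp {E F X : Type*} [TopologicalSpace E] [TopologicalSpace F]
    [TopologicalSpace X] {p : E → X} {q : F → X} {π : E → F} (h : q ∘ π = p) :
    deckGroup π ≤ deckGroup p := by
  subst h
  intro φ hφ e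
  exact congrArg q (hφ e)

/-- `A(E/F)` regarded as a subgroup of `A(E/X)`: the image of the inclusion
`A(E/F) → A(E/X)`. -/
def relativeDeckGroup {E F X : Type*} [TopologicalSpace E] [TopologicalSpace F]
    [TopologicalSpace X] (p : E → X) {q : F → X} (π : E → F) (h : q ∘ π = p) :
    Subgroup (deckGroup p) :=
  (Subgroup.inclusion (deckGroup_le_of_comp h)).range

/-! Everything turns on descent: which `φ` in A(E/X) satisfy `π ∘ φ = ψ ∘ π` for some `ψ` in A(F/X).
Lifts through `q` are unique, so this equality need only hold at one point; if `q` is Galois,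
transitivity supplies `ψ`. Conversely, if `p` is Galois then so is `π`, its fibres are
A(E/F)-orbits, and normality makes `φ` permute them, so `φ` passes to the quotient `F`. Descent is
then a homomorphism A(E/X) → A(F/X) with kernel A(E/F), surjective because `p` is Galois. -/

section CoveringDeck

variable {E F X : Type*} [TopologicalSpace E] [TopologicalSpace F] [TopologicalSpace X]

/-- A covering map from a nonempty space onto a path-connected space is surjective. -/
theorem IsCoveringMap.surjective_of_pathConnectedSpace [Nonempty E] [PathConnectedSpace X]
    {p : E → X} (hp : IsCoveringMap p) : Function.Surjective p := by
  intro x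
  obtain ⟨e⟩ := ‹Nonempty E›
  let γ : Path (p e) x := PathConnectedSpace.somePath (p e) x
  refine ⟨hp.liftPath γ e γ.source 1, ?_⟩
  exact (congrFun (hp.liftPath_lifts γ e γ.source) 1).trans γ.target

theorem mem_deckGroup_iff {p : E → X} {φ : E ≃ₜ E} : φ ∈ deckGroup p ↔ ∀ e, p (φ e) = p e :=
  Iff.rfl

theorem deckGroup_apply {p : E → X} (φ : deckGroup p) (e : E) : p (φ.1 e) = p e :=
  φ.2 e

variable {p : E → X} {q : F → X} {π : E → F}

theorem mem_relativeDeckGroup_iff (h : q ∘ π = p) {φ : deckGroup p} :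
    φ ∈ relativeDeckGroup p π h ↔ ∀ e, π (φ.1 e) = π e := by
  constructor
  · rintro ⟨ψ, rfl⟩
    exact ψ.2
  · intro hφ
    exact ⟨⟨φ.1, hφ⟩, rfl⟩

/-- A deck transformation `φ` of `p = q ∘ π` intertwines along `π` with a deck transformation `ψ`
of `q` as soon as it does so at one point. -/
theorem deckGroup_comp_eq_of_apply_eq [PreconnectedSpace E] (hq : IsCoveringMap q)
    (hπ : Continuous π) (h : q ∘ π = p) (φ : deckGroup p) (ψ : deckGroup q) {e₀ : E}
    (h₀ : π (φ.1 e₀) = ψ.1 (π e₀)) (e : E) : π (φ.1 e) = ψ.1 (π e) := by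
  -- Both sides are lifts of `p` through `q` on the connected space `E`.
  refine congrFun (hq.eq_of_comp_eq (g₁ := fun e => π (φ.1 e)) (g₂ := fun e => ψ.1 (π e))
    (hπ.comp φ.1.continuous) (ψ.1.continuous.comp hπ) ?_ e₀ h₀) e
  funext e
  exact (congrFun h (φ.1 e)).trans
    ((deckGroup_apply φ e).trans ((congrFun h e).symm.trans (deckGroup_apply ψ (π e)).symm))

/-- If `p = q ∘ π` is Galois, then so is `π`. -/
theorem IsGaloisCovering.of_comp [PreconnectedSpace E] (hp : IsGaloisCovering p)
    (hq : IsCoveringMap q) (hπ : IsCoveringMap π) (h : q ∘ π = p) : IsGaloisCovering π := by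
  refine ⟨hπ, fun e e' hee' => ?_⟩
  have hpe : p e = p e' := by
    rw [← h]
    exact congrArg q hee'
  obtain ⟨φ, hφ, rfl⟩ := hp.2 e e' hpe
  -- Taking `ψ = 1`: `φ` lies over the identity of `F` at `e`, hence everywhere.
  exact ⟨φ, deckGroup_comp_eq_of_apply_eq hq hπ.continuous h ⟨φ, hφ⟩ 1 hee'.symm, rfl⟩

/-- If `q` is Galois, every deck transformation of `q ∘ π` descends along `π`. -/
theorem exists_deckGroup_descent [ConnectedSpace E] (hq : IsGaloisCovering q)
    (hπ : Continuous π) (h : q ∘ π = p) (φ : deckGroup p) :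
    ∃ ψ : deckGroup q, ∀ e, π (φ.1 e) = ψ.1 (π e) := by
  obtain ⟨e₀⟩ : Nonempty E := inferInstance
  obtain ⟨ψ, hψ, hψ₀⟩ := hq.2 (π e₀) (π (φ.1 e₀))
    ((congrFun h e₀).trans ((deckGroup_apply φ e₀).symm.trans (congrFun h (φ.1 e₀)).symm))
  exact ⟨⟨ψ, hψ⟩, deckGroup_comp_eq_of_apply_eq hq.1 hπ h φ ⟨ψ, hψ⟩ hψ₀.symm⟩

/-- If `φ` lies over `ψ` and `n` over the identity, then `φ n φ⁻¹` lies over `ψ ψ⁻¹ = 1`. -/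
theorem normal_relativeDeckGroup_of_descent (h : q ∘ π = p)
    (hd : ∀ φ : deckGroup p, ∃ ψ : deckGroup q, ∀ e, π (φ.1 e) = ψ.1 (π e)) :
    (relativeDeckGroup p π h).Normal := by
  refine ⟨fun n hn φ => ?_⟩
  rw [mem_relativeDeckGroup_iff] at hn ⊢
  intro e
  obtain ⟨ψ, hψ⟩ := hd φ
  calc π (φ.1 (n.1 (φ.1.symm e))) = ψ.1 (π (n.1 (φ.1.symm e))) := hψ _
    _ = ψ.1 (π (φ.1.symm e)) := by rw [hn]
    _ = π (φ.1 (φ.1.symm e)) := (hψ _).symm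
    _ = π e := by rw [Homeomorph.apply_symm_apply]

/-- If `π` is Galois and `A(E/F)` is normal, then every `φ ∈ A(E/X)` preserves the partition of
`E` into fibres of `π`. -/
theorem apply_eq_of_normal_relativeDeckGroup (hπ : IsGaloisCovering π) (h : q ∘ π = p)
    (hn : (relativeDeckGroup p π h).Normal) (φ : deckGroup p) {e e' : E} (hee' : π e = π e') :
    π (φ.1 e) = π (φ.1 e') := by
  obtain ⟨n, hnπ, rfl⟩ := hπ.2 e e' hee'
  -- The conjugate `φ n φ⁻¹` sends `φ e` to `φ (n e)`, so these share a fibre of `π`.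
  have hmem := hn.conj_mem ⟨n, deckGroup_le_of_comp h hnπ⟩
    ((mem_relativeDeckGroup_iff h).2 hnπ) φ
  have key : π (φ.1 (n (φ.1.symm (φ.1 e)))) = π (φ.1 e) :=
    (mem_relativeDeckGroup_iff h).1 hmem (φ.1 e)
  rw [Homeomorph.symm_apply_apply] at key
  exact key.symm

/-- If `π` is Galois and surjective and `A(E/F)` is normal, every deck transformation of `q ∘ π`
descends along `π`. -/
theorem exists_deckGroup_descent_of_normal (hπ : IsGaloisCovering π)
    (hsurj : Function.Surjective π) (h : q ∘ π = p) (hn : (relativeDeckGroup p π h).Normal)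
    (φ : deckGroup p) : ∃ ψ : deckGroup q, ∀ e, π (φ.1 e) = ψ.1 (π e) := by
  have hquot := hπ.1.isQuotientMap hsurj
  have descend (χ : deckGroup p) : ∃ g : F → F, Continuous g ∧ ∀ e, π (χ.1 e) = g (π e) := by
    have hg (e : E) : π (χ.1 (Function.surjInv hsurj (π e))) = π (χ.1 e) :=
      apply_eq_of_normal_relativeDeckGroup hπ h hn χ (Function.surjInv_eq hsurj (π e))
    refine ⟨fun f => π (χ.1 (Function.surjInv hsurj f)), ?_, fun e => (hg e).symm⟩
    rw [hquot.continuous_iff]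
    exact (hπ.1.continuous.comp χ.1.continuous).congr fun e => (hg e).symm
  obtain ⟨g, hgc, hg⟩ := descend φ
  -- Descending the inverse as well makes `g` a homeomorphism.
  obtain ⟨g', hgc', hg'⟩ := descend φ⁻¹
  have hg'symm (e : E) : g' (π e) = π (φ.1.symm e) := (hg' e).symm
  let ψ : F ≃ₜ F :=
    { toFun := g
      invFun := g'
      left_inv := hsurj.forall.2 fun e => by
        rw [← hg, hg'symm, Homeomorph.symm_apply_apply]
      right_inv := hsurj.forall.2 fun e => by
        rw [hg'symm, ← hg, Homeomorph.apply_symm_apply]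
      continuous_toFun := hgc
      continuous_invFun := hgc' }
  refine ⟨⟨ψ, mem_deckGroup_iff.2 (hsurj.forall.2 fun e => ?_)⟩, hg⟩
  have : ψ (π e) = π (φ.1 e) := (hg e).symm
  rw [this]
  exact (congrFun h (φ.1 e)).trans ((deckGroup_apply φ e).trans (congrFun h e).symm)

/-- If all deck transformations of the Galois covering `q ∘ π` descend along the surjection `π`,
then `q` is Galois. -/
theorem IsGaloisCovering.of_descent (hp : IsGaloisCovering p) (hq : IsCoveringMap q)
    (hsurj : Function.Surjective π) (h : q ∘ π = p)
    (hd : ∀ φ : deckGroup p, ∃ ψ : deckGroup q, ∀ e, π (φ.1 e) = ψ.1 (π e)) :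
    IsGaloisCovering q := by
  refine ⟨hq, hsurj.forall.2 fun e => hsurj.forall.2 fun e' hee' => ?_⟩
  obtain ⟨φ, hφ, rfl⟩ := hp.2 e e' (by rw [← h]; exact hee')
  obtain ⟨ψ, hψ⟩ := hd ⟨φ, hφ⟩
  exact ⟨ψ.1, ψ.2, (hψ e).symm⟩

/-- The homomorphism `A(E/X) → A(F/X)` defined by descending deck transformations along `π`. -/
noncomputable def deckGroupDescent (hsurj : Function.Surjective π)
    (hd : ∀ φ : deckGroup p, ∃ ψ : deckGroup q, ∀ e, π (φ.1 e) = ψ.1 (π e)) :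
    deckGroup p →* deckGroup q :=
  -- Surjectivity of `π` makes descents unique, so the chosen ones multiply correctly.
  MonoidHom.mk' (fun φ => (hd φ).choose) fun φ χ => by
    refine Subtype.ext (Homeomorph.ext (hsurj.forall.2 fun e => ?_))
    calc (hd (φ * χ)).choose.1 (π e) = π (φ.1 (χ.1 e)) := ((hd (φ * χ)).choose_spec e).symm
      _ = (hd φ).choose.1 (π (χ.1 e)) := (hd φ).choose_spec _
      _ = (hd φ).choose.1 ((hd χ).choose.1 (π e)) := by rw [(hd χ).choose_spec e]

section Descent

variable (hsurj : Function.Surjective π)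
  (hd : ∀ φ : deckGroup p, ∃ ψ : deckGroup q, ∀ e, π (φ.1 e) = ψ.1 (π e))

theorem deckGroupDescent_apply (φ : deckGroup p) (e : E) :
    (deckGroupDescent hsurj hd φ).1 (π e) = π (φ.1 e) :=
  ((hd φ).choose_spec e).symm

theorem ker_deckGroupDescent (h : q ∘ π = p) :
    (deckGroupDescent hsurj hd).ker = relativeDeckGroup p π h := by
  ext φ
  rw [MonoidHom.mem_ker, mem_relativeDeckGroup_iff]
  constructor
  · intro hφ e
    rw [← deckGroupDescent_apply hsurj hd, hφ]
    rfl
  · intro hφ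
    refine Subtype.ext (Homeomorph.ext (hsurj.forall.2 fun e => ?_))
    exact (deckGroupDescent_apply hsurj hd φ e).trans (hφ e)

/-- Some `φ` carries `e₀` to a point above `ψ (π e₀)`; its descent then agrees with `ψ` at `π e₀`,
and so everywhere. -/
theorem deckGroupDescent_surjective [ConnectedSpace E] (hp : IsGaloisCovering p)
    (hq : IsCoveringMap q) (hπ : Continuous π) (h : q ∘ π = p) :
    Function.Surjective (deckGroupDescent hsurj hd) := by
  intro ψ
  obtain ⟨e₀⟩ : Nonempty E := inferInstance
  obtain ⟨e₁, he₁⟩ := hsurj (ψ.1 (π e₀))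
  have hpe : p e₀ = p e₁ := by
    rw [← h]
    exact (deckGroup_apply ψ (π e₀)).symm.trans (congrArg q he₁).symm
  obtain ⟨φ, hφ, rfl⟩ := hp.2 e₀ e₁ hpe
  refine ⟨⟨φ, hφ⟩, Subtype.ext (Homeomorph.ext (hsurj.forall.2 fun e => ?_))⟩
  exact (deckGroupDescent_apply hsurj hd _ e).trans
    (deckGroup_comp_eq_of_apply_eq hq hπ h ⟨φ, hφ⟩ ψ he₁ e)

end Descent

end CoveringDeck

theorem mainTheorem4 {E F X : Type*} [TopologicalSpace E] [TopologicalSpace F]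
    [TopologicalSpace X] [PathConnectedSpace X] [LocallyPathConnectedSpace X] [T2Space X]
    [PathConnectedSpace E] [PathConnectedSpace F]
    (p : E → X) (q : F → X) (π : E → F)
    (hp : IsCoveringMap p) (hq : IsCoveringMap q) (hπ : IsCoveringMap π)
    (hcomm : q ∘ π = p) :
    (IsGaloisCovering p →
      (IsGaloisCovering q ↔ (relativeDeckGroup p π hcomm).Normal)) ∧
    (IsGaloisCovering p → IsGaloisCovering q →
      ∃ _ : (relativeDeckGroup p π hcomm).Normal,
        Nonempty (deckGroup q ≃* (deckGroup p ⧸ relativeDeckGroup p π hcomm))) := by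
  have hsurj : Function.Surjective π := hπ.surjective_of_pathConnectedSpace
  refine ⟨fun hpG => ⟨fun hqG => ?_, fun hn => ?_⟩, fun hpG hqG => ?_⟩
  · exact normal_relativeDeckGroup_of_descent hcomm
      (exists_deckGroup_descent hqG hπ.continuous hcomm)
  · exact hpG.of_descent hq hsurj hcomm
      (exists_deckGroup_descent_of_normal (hpG.of_comp hq hπ hcomm) hsurj hcomm hn)
  · have hd := exists_deckGroup_descent hqG hπ.continuous hcomm
    have hn := normal_relativeDeckGroup_of_descent hcomm hd
    refine ⟨hn, ⟨?_⟩⟩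
    exact ((QuotientGroup.quotientMulEquivOfEq (ker_deckGroupDescent hsurj hd hcomm)).symm.trans
      (QuotientGroup.quotientKerEquivOfSurjective (deckGroupDescent hsurj hd)
        (deckGroupDescent_surjective hsurj hd hpG hq hπ.continuous hcomm))).symm
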